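/- Let $S\subset\mathbb R^N$ be compact and let $\mathcal M(S)^N$ be the space of finite $\mathbb R^N$-valued Borel measures on $S$, with total variation norm $\|\cdot\|_{TV}$ (the Euclidean norm being used on $\mathbb R^N$) and with the weak-star topology given by the pairing $\langle\varphi,\mu\rangle=\int\varphi\cdot d\mu$ with $C(S)^N$. Write $\operatorname{supp}\mu$ for the support of the total variation measure $|\mu|$. Let $\mathcal H$ be a real Hilbert space and $A:\mathcal M(S)^N\to\mathcal H$ a linear operator that is continuous from the weak-star topology to the weak topology of $\mathcal H$; let $A^*:\mathcal H\to C(S)^N$ be its adjoint, so $\langle A^*g,\mu\rangle=\langle g,A\mu\rangle_{\mathcal H}$. For $\lambda>0$, $f\in\mathcal H$ put $\mathcal F(\mu)=\|f-A\mu\|_{\mathcal H}^2+\lambda\|\mu\|_{TV}$. For a subspace $V\subset\mathcal M(S)^N$ let $\mu^V_{\lambda,f}$ denote a minimizer of $\mathcal F$ over $V$, and write $\mu_{\lambda,f}$ when $V=\mathcal M(S)^N$. A *GSM space* with generating measures $(\nu_k)_{k\in I}$, $I\subset\mathbb N$, where the $\nu_k$ are mutually singular Borel probability measures on $S$, is the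 space of all $\mu=\sum_{k\in I}m_k\nu_k$ with $m_k\in\mathbb R^N$ and $\sum_k|m_k|<\infty$. A Borel partition $(E_k)_{k\in I}$ of $S$ is *compatible* with it if $\nu_k(E_j)=\delta_{jk}$ for all $j,k\in I$. Let $V_1\subset V_2\subset\cdots$ be weak-star closed GSM spaces with generating measures $(\nu^n_k)_{k\in I_n}$, let $(E^n_k)_{k\in I_n}$ be a partition compatible with $V_n$, and assume $a_n:=\sup_{k\in I_n}\operatorname{diam}E^n_k\to0$. Let $\mu_{\lambda,f}$ be a minimizer of $\mathcal F$ over $\mathcal M(S)^N$ and, for each $n$, let $\mu^{V_n}_{\lambda,f}$ be any minimizer of $\mathcal F$ over $V_n$. Put $L_{\lambda/2}=\{x\in S:|A^*(f-A\mu_{\lambda,f})(x)|=\lambda/2\}$. (Distances to the empty set are $+\infty$ and a supremum over the empty set is $0$.) Then: 1. $\displaystyle\sup_{x\in\operatorname{supp}\mu^{V_n}_{\lambda,f}}d(x,L_{\lambda/2})\to0$ as $n\to\infty$, and every compact set $C\subset S$ that is a cluster point of $(\operatorname{supp}\mu^{V_n}_{\lambda,f})_n$ for the Hausdorff distance satisfies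 $C\subset L_{\lambda/2}$. 2. If $\mu_{\lambda,f}$ is the only minimizer of $\mathcal F$ over $\mathcal M(S)^N$, then $\displaystyle\sup_{x\in\operatorname{supp}\mu_{\lambda,f}}d\bigl(x,\operatorname{supp}\mu^{V_n}_{\lambda,f}\bigr)\to0$ as $n\to\infty$, and every such $C$ satisfies $\operatorname{supp}\mu_{\lambda,f}\subset C\subset L_{\lambda/2}$. -/

import Mathlib

open MeasureTheory Filter Topology
open scoped ENNReal

/-- The space `M(S)^N` of finite `ℝ^N`-valued Borel measures on `S ⊆ ℝ^N`. -/
abbrev VecMeas {N : ℕ} (S : Set (EuclideanSpace ℝ (Fin N))) : Type :=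
  VectorMeasure S (EuclideanSpace ℝ (Fin N))

namespace VecMeas

variable {N : ℕ} {S : Set (EuclideanSpace ℝ (Fin N))}

/-- The variation `|μ|` of an `ℝ^N`-valued measure is always a finite measure. -/
instance isFiniteMeasure_variation (μ : VecMeas S) : IsFiniteMeasure μ.variation := by
  let c : Fin N → SignedMeasure S := fun i =>
    μ.mapRange (EuclideanSpace.proj i : EuclideanSpace ℝ (Fin N) →L[ℝ] ℝ).toLinearMap.toAddMonoidHom
      (EuclideanSpace.proj i : EuclideanSpace ℝ (Fin N) →L[ℝ] ℝ).continuous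
  have hle : μ.variation ≤ ∑ i, (c i).totalVariation := by
    refine VectorMeasure.variation_le_of_forall_enorm_le fun B _ => ?_
    rw [Measure.finsetSum_apply]
    have h1 : ‖μ B‖ₑ ≤ ∑ i, ‖c i B‖ₑ := by
      have h2 : μ B = ∑ i, EuclideanSpace.single i (c i B) := by
        ext j
        simp only [WithLp.ofLp_sum, Finset.sum_apply, PiLp.single_apply,
          Finset.sum_ite_eq, Finset.mem_univ, if_true]
        rfl
      calc ‖μ B‖ₑ = ‖∑ i, EuclideanSpace.single i (c i B)‖ₑ := by rw [← h2]
        _ ≤ ∑ i, ‖EuclideanSpace.single i (c i B)‖ₑ := enorm_sum_le _ _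
        _ = ∑ i, ‖c i B‖ₑ := by
          refine Finset.sum_congr rfl fun i _ => ?_
          simp [enorm_eq_nnnorm]
    exact h1.trans (Finset.sum_le_sum fun i _ => SignedMeasure.enorm_le_totalVariation _ _)
  refine ⟨(hle Set.univ).trans_lt ?_⟩
  rw [Measure.finsetSum_apply]
  refine ENNReal.sum_lt_top.2 fun i _ => ?_
  have : IsFiniteMeasure (c i).totalVariation := by
    unfold SignedMeasure.totalVariation
    infer_instance
  exact measure_lt_top _ _

/-- The total variation norm of `μ`. -/
noncomputable def tvNorm (μ : VecMeas S) : ℝ := (μ.variation Set.univ).toReal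

/-- The support of `μ`, that is, the support of the positive measure `|μ|`. -/
def supp (μ : VecMeas S) : Set S := μ.variation.support

/-- Continuous functions on a compact set are integrable against `μ`. -/
theorem integrable_continuousMap [CompactSpace S] (μ : VecMeas S)
    (φ : C(S, EuclideanSpace ℝ (Fin N))) : μ.Integrable φ :=
  φ.continuous.integrable_of_hasCompactSupport (HasCompactSupport.of_compactSpace _)

/-- The duality pairing `⟨φ, μ⟩ = ∫ φ · dμ` between `M(S)^N` and `C(S)^N`, as a bilinear map. -/
noncomputable def pairing (S : Set (EuclideanSpace ℝ (Fin N))) [CompactSpace S] :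
    VecMeas S →ₗ[ℝ] C(S, EuclideanSpace ℝ (Fin N)) →ₗ[ℝ] ℝ :=
  LinearMap.mk₂ ℝ (fun μ φ => μ.integral φ (innerSL ℝ))
    (fun μ ν φ => VectorMeasure.integral_add_vectorMeasure
      (integrable_continuousMap μ φ) (integrable_continuousMap ν φ))
    (fun c _ φ => VectorMeasure.integral_smul_vectorMeasure φ c)
    (fun μ φ ψ => VectorMeasure.integral_add
      (integrable_continuousMap μ φ) (integrable_continuousMap μ ψ))
    (fun c μ φ => VectorMeasure.integral_smul φ μ (innerSL ℝ) c)

theorem pairing_apply [CompactSpace S] (μ : VecMeas S) (φ : C(S, EuclideanSpace ℝ (Fin N))) :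
    pairing S μ φ = μ.integral φ (innerSL ℝ) := rfl

/-- The weak-star topology on `M(S)^N`: the coarsest topology for which all the functionals
`μ ↦ ⟨φ, μ⟩`, `φ ∈ C(S)^N`, are continuous. -/
@[reducible] noncomputable def weakStar (S : Set (EuclideanSpace ℝ (Fin N))) [CompactSpace S] :
    TopologicalSpace (VecMeas S) :=
  TopologicalSpace.induced
    (fun (μ : VecMeas S) (φ : C(S, EuclideanSpace ℝ (Fin N))) => pairing S μ φ) inferInstance

section Operator

variable [CompactSpace S] {H : Type*} [NormedAddCommGroup H] [InnerProductSpace ℝ H]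

/-- `A : M(S)^N → H` is continuous from the weak-star topology to the weak topology of the
Hilbert space `H`. -/
def IsWeakStarContinuous (A : VecMeas S →ₗ[ℝ] H) : Prop :=
  @Continuous (VecMeas S) (WeakSpace ℝ H) (weakStar S) inferInstance
    (fun μ => toWeakSpace ℝ H (A μ))

/-- A weak-star continuous `A : M(S)^N → H` has an adjoint `H → C(S)^N`. -/
theorem exists_adjoint {A : VecMeas S →ₗ[ℝ] H} (hA : IsWeakStarContinuous A) (g : H) :
    ∃ φ : C(S, EuclideanSpace ℝ (Fin N)), ∀ μ : VecMeas S, pairing S μ φ = inner ℝ g (A μ) := by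
  have hc : @Continuous (VecMeas S) ℝ (weakStar S) inferInstance
      (fun μ => inner ℝ g (A μ)) := by
    have h1 : Continuous (fun y : WeakSpace ℝ H => (topDualPairing ℝ H).flip y (innerSL ℝ g)) :=
      WeakBilin.eval_continuous (topDualPairing ℝ H).flip (innerSL ℝ g)
    exact @Continuous.comp (VecMeas S) (WeakSpace ℝ H) ℝ (weakStar S) _ _ _ _ h1 hA
  let L : StrongDual ℝ (WeakBilin (pairing S)) :=
    ⟨((innerSL ℝ g : H →L[ℝ] ℝ) : H →ₗ[ℝ] ℝ) ∘ₗ A, hc⟩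
  obtain ⟨φ, hφ⟩ := LinearMap.dualEmbedding_surjective (pairing S) L
  exact ⟨φ, fun μ => congrArg (fun T : StrongDual ℝ (WeakBilin (pairing S)) => T μ) hφ⟩

/-- The adjoint `A^* : H → C(S)^N` of a weak-star continuous operator `A : M(S)^N → H`,
characterized by `⟨A^* g, μ⟩ = ⟨g, A μ⟩` for all `μ`. -/
noncomputable def adjoint {A : VecMeas S →ₗ[ℝ] H} (hA : IsWeakStarContinuous A) (g : H) :
    C(S, EuclideanSpace ℝ (Fin N)) :=
  (exists_adjoint hA g).choose

theorem pairing_adjoint {A : VecMeas S →ₗ[ℝ] H} (hA : IsWeakStarContinuous A) (g : H)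
    (μ : VecMeas S) : pairing S μ (adjoint hA g) = inner ℝ g (A μ) :=
  (exists_adjoint hA g).choose_spec μ

/-- The defining property determines the adjoint. -/
theorem adjoint_unique {A : VecMeas S →ₗ[ℝ] H} (hA : IsWeakStarContinuous A) (g : H)
    (φ : C(S, EuclideanSpace ℝ (Fin N)))
    (hφ : ∀ μ : VecMeas S, pairing S μ φ = inner ℝ g (A μ)) : φ = adjoint hA g := by
  ext1 x
  refine ext_inner_right ℝ fun v => ?_
  have h : pairing S (VectorMeasure.dirac x v) φ
      = pairing S (VectorMeasure.dirac x v) (adjoint hA g) := by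
    rw [hφ, pairing_adjoint]
  rw [pairing_apply, pairing_apply, VectorMeasure.integral_dirac,
    VectorMeasure.integral_dirac] at h
  exact h

/-- The regularized functional `‖f - A μ‖² + lam ‖μ‖_TV`. -/
noncomputable def objective (A : VecMeas S →ₗ[ℝ] H) (lam : ℝ) (f : H) (μ : VecMeas S) : ℝ :=
  ‖f - A μ‖ ^ 2 + lam * tvNorm μ

/-- `μ` is a minimizer of the regularized functional over `V`. -/
def IsMinimizer (A : VecMeas S →ₗ[ℝ] H) (lam : ℝ) (f : H) (V : Submodule ℝ (VecMeas S))
    (μ : VecMeas S) : Prop :=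
  μ ∈ V ∧ ∀ ν ∈ V, objective A lam f μ ≤ objective A lam f ν

/-- The level set `{x ∈ S : |A^*(f - A μ)(x)| = α}`. -/
def levelSet {A : VecMeas S →ₗ[ℝ] H} (hA : IsWeakStarContinuous A) (f : H) (μ : VecMeas S)
    (α : ℝ) : Set S :=
  {x | ‖adjoint hA (f - A μ) x‖ = α}

end Operator

/-- A (countable) family of mutually singular Borel probability measures on `S`. -/
structure IsGeneratingFamily {I : Set ℕ} (ν : I → Measure S) : Prop where
  isProbabilityMeasure : ∀ k, IsProbabilityMeasure (ν k)
  mutuallySingular : ∀ j k, j ≠ k → (ν j).MutuallySingular (ν k)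

/-- The space `V(ν)` of all measures of the form `∑ₖ mₖ νₖ` with `mₖ ∈ ℝ^N` and
`∑ₖ |mₖ| < ∞`. -/
def gsmSpace {I : Set ℕ} (ν : I → Measure S) : Submodule ℝ (VecMeas S) where
  carrier := {μ | ∃ m : I → EuclideanSpace ℝ (Fin N), Summable (fun k => ‖m k‖) ∧
    ∀ B : Set S, MeasurableSet B → HasSum (fun k => (ν k).real B • m k) (μ B)}
  zero_mem' := ⟨0, by simp [summable_zero], fun B _ => by simp [hasSum_zero]⟩
  add_mem' := by
    rintro μ₁ μ₂ ⟨m₁, h₁, h₁'⟩ ⟨m₂, h₂, h₂'⟩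
    refine ⟨m₁ + m₂, Summable.of_nonneg_of_le (fun _ => norm_nonneg _)
      (fun k => norm_add_le _ _) (h₁.add h₂), fun B hB => ?_⟩
    simpa [smul_add] using (h₁' B hB).add (h₂' B hB)
  smul_mem' := by
    rintro c μ ⟨m, h, h'⟩
    refine ⟨c • m, by simpa [norm_smul] using h.mul_left |c|, fun B hB => ?_⟩
    simpa [smul_comm c] using (h' B hB).const_smul c

/-- `E` is a Borel partition of `S` compatible with the generating family `ν`:
`νₖ(E_j) = δ_{jk}`. -/
structure IsCompatiblePartition {I : Set ℕ} (ν : I → Measure S) (E : I → Set S) : Prop where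
  measurableSet : ∀ k, MeasurableSet (E k)
  disjoint : ∀ j k, j ≠ k → Disjoint (E j) (E k)
  iUnion_eq : ⋃ k, E k = Set.univ
  apply_self : ∀ k, ν k (E k) = 1
  apply_ne : ∀ j k, j ≠ k → ν k (E j) = 0

/-- `C` is a cluster point of the sequence of sets `K` for the Hausdorff distance. -/
def IsHausdorffClusterPt (K : ℕ → Set S) (C : Set S) : Prop :=
  ∀ ε : ℝ≥0∞, 0 < ε → ∃ᶠ n in atTop, Metric.hausdorffEDist (K n) C < ε

end VecMeas

/-! The discrete problems are compared with the full one through the dual certificates `p = A^*(f -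
Aμ)` and `pₙ = A^*(f - Aμₙ)`.

Replacing `μ` by `∑ μ(Eₖ) νₖ` over finitely many cells does not increase the norm and, for a fixed
test function, changes the pairing little once the mesh is small
(`IsCompatiblePartition.exists_abs_pairing_sub_le`). Only weak approximation of `Aμ` results; since
the competitors of norm at most `‖μ‖` in the nested union form a convex set, Hahn–Banach upgrades it
to strong approximation (`mem_closure_image`). Hence the minimal values converge. The quadratic term
controls `‖Aμₙ - Aμ‖²` by the gap in values (`IsMinimizer.sq_norm_sub_le`), so `Aμₙ → Aμ` in norm,
`‖μₙ‖ → ‖μ‖`, and `pₙ → p` uniformly because `A^*` is bounded.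

For assertion 1, each restriction of `μₙ` to a cell stays in `Vₙ`, so optimality can be tested cell
by cell: a cell charged by `μₙ` cannot contain a point where `|pₙ|` is below `λ/2` by more than its
oscillation there (`IsMinimizer.le_norm_adjoint_of_mem_supp`). As `|p| ≤ λ/2`, with a uniform gap
away from the level set by compactness, the supports concentrate near that set.

For assertion 2, every weak-star limit of `(μₙ)` along an ultrafilter is again a minimizer, hence
equals `μ`; weak-star convergence then prevents the supports from leaving holes near `supp μ`
(`tendsto_iSup_infEDist_supp`). -/

namespace VecMeas

/-! ### Total variation norm and measures with constant direction -/

section Variation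

variable {N : ℕ} {S : Set (EuclideanSpace ℝ (Fin N))}

theorem tvNorm_eq_real (μ : VecMeas S) : tvNorm μ = μ.variation.real Set.univ := rfl

theorem tvNorm_nonneg (μ : VecMeas S) : 0 ≤ tvNorm μ := ENNReal.toReal_nonneg

theorem tvNorm_zero : tvNorm (0 : VecMeas S) = 0 := by
  simp [tvNorm]

theorem tvNorm_add_le (μ η : VecMeas S) : tvNorm (μ + η) ≤ tvNorm μ + tvNorm η := by
  rw [tvNorm_eq_real, tvNorm_eq_real, tvNorm_eq_real, ← measureReal_add_apply]
  exact ENNReal.toReal_mono (measure_ne_top _ _) (VectorMeasure.variation_add_le _)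

theorem tvNorm_smul (c : ℝ) (μ : VecMeas S) : tvNorm (c • μ) = |c| * tvNorm μ := by
  simp [tvNorm, VectorMeasure.variation_smul]

theorem tvNorm_neg (μ : VecMeas S) : tvNorm (-μ) = tvNorm μ := by
  simp [tvNorm, VectorMeasure.variation_neg]

theorem tvNorm_sum_le {ι : Type*} (s : Finset ι) (μ : ι → VecMeas S) :
    tvNorm (∑ i ∈ s, μ i) ≤ ∑ i ∈ s, tvNorm (μ i) := by
  classical
  induction s using Finset.induction_on with
  | empty => simp [tvNorm_zero]
  | insert a s ha ih =>
    rw [Finset.sum_insert ha, Finset.sum_insert ha]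
    exact (tvNorm_add_le _ _).trans (by gcongr)

theorem tvNorm_restrict (μ : VecMeas S) {B : Set S} (hB : MeasurableSet B) :
    tvNorm (μ.restrict B) = μ.variation.real B := by
  rw [tvNorm_eq_real, VectorMeasure.variation_restrict hB, measureReal_restrict_apply_univ]

theorem tvNorm_restrict_add_compl (μ : VecMeas S) {B : Set S} (hB : MeasurableSet B) :
    tvNorm (μ.restrict B) + tvNorm (μ.restrict Bᶜ) = tvNorm μ := by
  rw [tvNorm_restrict μ hB, tvNorm_restrict μ hB.compl, measureReal_add_measureReal_compl hB,
    tvNorm_eq_real]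

theorem tvNorm_dirac (x : S) (v : EuclideanSpace ℝ (Fin N)) :
    tvNorm (VectorMeasure.dirac x v : VecMeas S) = ‖v‖ := by
  simp [tvNorm]

/-- The vector measure `B ↦ ν B • v`. -/
noncomputable def ofMeasure (ν : Measure S) [IsFiniteMeasure ν]
    (v : EuclideanSpace ℝ (Fin N)) : VecMeas S :=
  ν.toSignedMeasure.mapRange
    ((ContinuousLinearMap.id ℝ ℝ).smulRight v).toLinearMap.toAddMonoidHom
    ((ContinuousLinearMap.id ℝ ℝ).smulRight v).continuous

theorem ofMeasure_apply (ν : Measure S) [IsFiniteMeasure ν] (v : EuclideanSpace ℝ (Fin N))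
    {B : Set S} (hB : MeasurableSet B) : ofMeasure ν v B = ν.real B • v := by
  simp [ofMeasure, hB]

theorem variation_ofMeasure_le (ν : Measure S) [IsFiniteMeasure ν]
    (v : EuclideanSpace ℝ (Fin N)) : (ofMeasure ν v).variation ≤ ‖v‖₊ • ν := by
  refine VectorMeasure.variation_le_of_forall_enorm_le fun B hB => ?_
  rw [ofMeasure_apply ν v hB, enorm_smul, Measure.smul_apply, mul_comm]
  refine le_of_eq ?_
  rw [Real.enorm_of_nonneg measureReal_nonneg, ofReal_measureReal]
  rfl

theorem tvNorm_ofMeasure_le (ν : Measure S) [IsFiniteMeasure ν]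
    (v : EuclideanSpace ℝ (Fin N)) : tvNorm (ofMeasure ν v) ≤ ν.real Set.univ * ‖v‖ := by
  have h := variation_ofMeasure_le ν v Set.univ
  have h2 := ENNReal.toReal_mono (measure_ne_top _ _) h
  simpa [tvNorm, Measure.real, mul_comm] using h2

theorem isClosed_supp (μ : VecMeas S) : IsClosed μ.supp :=
  Measure.isClosed_support

end Variation

/-! ### The duality pairing -/

section Pairing

variable {N : ℕ} {S : Set (EuclideanSpace ℝ (Fin N))} [CompactSpace S]

theorem abs_pairing_le_integral (μ : VecMeas S) (φ : C(S, EuclideanSpace ℝ (Fin N))) :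
    |pairing S μ φ| ≤ ∫ x, ‖φ x‖ ∂μ.variation := by
  rw [pairing_apply, ← Real.norm_eq_abs]
  refine VectorMeasure.norm_integral_le_integral_norm.trans ?_
  refine mul_le_of_le_one_left (integral_nonneg fun _ => norm_nonneg _) ?_
  exact norm_innerSL_le _

theorem abs_pairing_le_of_ae (μ : VecMeas S) (φ : C(S, EuclideanSpace ℝ (Fin N))) {c : ℝ}
    (h : ∀ᵐ x ∂μ.variation, ‖φ x‖ ≤ c) : |pairing S μ φ| ≤ c * tvNorm μ := by
  refine (abs_pairing_le_integral μ φ).trans ?_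
  refine (integral_mono_ae (integrable_continuousMap μ φ).norm (integrable_const c) h).trans ?_
  simp [tvNorm_eq_real, mul_comm]

theorem abs_pairing_le (μ : VecMeas S) (φ : C(S, EuclideanSpace ℝ (Fin N))) :
    |pairing S μ φ| ≤ ‖φ‖ * tvNorm μ :=
  abs_pairing_le_of_ae μ φ (Eventually.of_forall fun x => φ.norm_coe_le_norm x)

theorem pairing_const (μ : VecMeas S) (v : EuclideanSpace ℝ (Fin N)) :
    pairing S μ (ContinuousMap.const S v) = inner ℝ v (μ Set.univ) := by
  rw [pairing_apply]
  exact VectorMeasure.integral_const v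

theorem pairing_dirac (x : S) (v : EuclideanSpace ℝ (Fin N))
    (φ : C(S, EuclideanSpace ℝ (Fin N))) :
    pairing S (VectorMeasure.dirac x v) φ = inner ℝ (φ x) v := by
  rw [pairing_apply, VectorMeasure.integral_dirac]
  rfl

/-- A vector integral sees the measure and the bilinear map only through their transpose; this
reduces pairing with `ofMeasure ν v` to a scalar integral. -/
theorem integral_eq_of_transpose_eq {X E F₁ F₂ G : Type*} {mX : MeasurableSpace X}
    [NormedAddCommGroup E] [NormedSpace ℝ E] [NormedAddCommGroup F₁] [NormedSpace ℝ F₁]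
    [NormedAddCommGroup F₂] [NormedSpace ℝ F₂] [NormedAddCommGroup G] [NormedSpace ℝ G]
    {μ₁ : VectorMeasure X F₁} {μ₂ : VectorMeasure X F₂} {B₁ : E →L[ℝ] F₁ →L[ℝ] G}
    {B₂ : E →L[ℝ] F₂ →L[ℝ] G} {f : X → E} (h₁ : μ₁.Integrable f) (h₂ : μ₂.Integrable f)
    (h : μ₁.transpose B₁ = μ₂.transpose B₂) : μ₁.integral f B₁ = μ₂.integral f B₂ := by
  rw [VectorMeasure.integral_eq_setToFun_transpose h₁,
    VectorMeasure.integral_eq_setToFun_transpose h₂]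
  simp only [h]

theorem pairing_ofMeasure (ν : Measure S) [IsFiniteMeasure ν] (v : EuclideanSpace ℝ (Fin N))
    (φ : C(S, EuclideanSpace ℝ (Fin N))) :
    pairing S (ofMeasure ν v) φ = ∫ x, inner ℝ (φ x) v ∂ν := by
  have hφ : ν.toSignedMeasure.Integrable φ := by
    change Integrable φ ν.toSignedMeasure.variation
    rw [Measure.variation_toSignedMeasure]
    exact φ.continuous.integrable_of_hasCompactSupport (HasCompactSupport.of_compactSpace _)
  have h1 : ∫ x, inner ℝ (φ x) v ∂ν
      = ν.toSignedMeasure.integral (fun x => (innerSL ℝ).flip v (φ x))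
        (ContinuousLinearMap.lsmul ℝ ℝ).flip := by
    rw [VectorMeasure.integral_toSignedMeasure]
    rfl
  rw [h1, VectorMeasure.integral_continuousLinearMap_comp hφ, pairing_apply]
  refine integral_eq_of_transpose_eq (integrable_continuousMap _ φ) hφ ?_
  ext B hB x
  simp [VectorMeasure.transpose, ofMeasure_apply ν v hB, hB]

end Pairing

/-! ### Jordan decomposition of the coordinates -/

section Coordinates

variable {N : ℕ} {S : Set (EuclideanSpace ℝ (Fin N))}

theorem integral_indicator_inner (μ : VecMeas S) {B : Set S} (hB : MeasurableSet B)
    (v : EuclideanSpace ℝ (Fin N)) :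
    μ.integral (B.indicator fun _ => v) (innerSL ℝ) = inner ℝ v (μ B) :=
  VectorMeasure.integral_indicator_const v hB

/-- A coordinate of a vector measure. -/
noncomputable def coord (μ : VecMeas S) (i : Fin N) : SignedMeasure S :=
  μ.mapRange (EuclideanSpace.proj i : EuclideanSpace ℝ (Fin N) →L[ℝ] ℝ).toLinearMap.toAddMonoidHom
    (EuclideanSpace.proj i : EuclideanSpace ℝ (Fin N) →L[ℝ] ℝ).continuous

theorem coord_apply (μ : VecMeas S) (i : Fin N) (B : Set S) : coord μ i B = μ B i := rfl

theorem variation_coord_le (μ : VecMeas S) (i : Fin N) : (coord μ i).variation ≤ μ.variation := by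
  refine VectorMeasure.variation_le_of_forall_enorm_le fun B _ => ?_
  refine le_trans ?_ (VectorMeasure.enorm_measure_le_variation μ B)
  rw [coord_apply, enorm_le_iff_norm_le]
  exact PiLp.norm_apply_le (μ B) i

/-- The positive part of a coordinate of a vector measure. -/
noncomputable def coordPos (μ : VecMeas S) (i : Fin N) : FiniteMeasure S :=
  ⟨(coord μ i).toJordanDecomposition.posPart, inferInstance⟩

/-- The negative part of a coordinate of a vector measure. -/
noncomputable def coordNeg (μ : VecMeas S) (i : Fin N) : FiniteMeasure S :=
  ⟨(coord μ i).toJordanDecomposition.negPart, inferInstance⟩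

theorem coordPos_add_coordNeg_le (μ : VecMeas S) (i : Fin N) :
    (coordPos μ i : Measure S) + coordNeg μ i ≤ μ.variation := by
  refine le_trans (le_of_eq ?_) (variation_coord_le μ i)
  rw [← SignedMeasure.totalVariation_eq_variation]
  rfl

theorem mass_coordPos_le (μ : VecMeas S) (i : Fin N) :
    (coordPos μ i).mass ≤ (tvNorm μ).toNNReal := by
  have h := (Measure.le_add_right le_rfl).trans (coordPos_add_coordNeg_le μ i) Set.univ
  have h2 := ENNReal.toNNReal_mono (measure_ne_top _ _) h
  rwa [tvNorm, ENNReal.toReal, Real.toNNReal_coe]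

theorem mass_coordNeg_le (μ : VecMeas S) (i : Fin N) :
    (coordNeg μ i).mass ≤ (tvNorm μ).toNNReal := by
  have h := (Measure.le_add_left le_rfl).trans (coordPos_add_coordNeg_le μ i) Set.univ
  have h2 := ENNReal.toNNReal_mono (measure_ne_top _ _) h
  rwa [tvNorm, ENNReal.toReal, Real.toNNReal_coe]

/-- Reduces weak-star compactness to the compactness of bounded sets of positive measures. -/
theorem eq_sum_ofMeasure_coord (μ : VecMeas S) :
    μ = ∑ i, (ofMeasure (coordPos μ i : Measure S) (EuclideanSpace.single i 1)
      - ofMeasure (coordNeg μ i : Measure S) (EuclideanSpace.single i 1)) := by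
  ext B hB j
  have h : μ B j = (coordPos μ j : Measure S).real B - (coordNeg μ j : Measure S).real B :=
    SignedMeasure.apply_eq_posPart_real_sub_negPart_real (coord μ j) hB
  rw [h]
  simp [ofMeasure_apply _ _ hB, Finset.sum_apply, Pi.single_apply]

end Coordinates

/-! ### Testing against continuous functions -/

section Density

variable {N : ℕ} {S : Set (EuclideanSpace ℝ (Fin N))} [CompactSpace S]

/-- The radial retraction onto the closed unit ball moves a point no further than its distance to
any point of the ball. -/
theorem norm_retraction_sub_le {F : Type*} [NormedAddCommGroup F] [NormedSpace ℝ F] (x y : F)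
    (hy : ‖y‖ ≤ 1) : ‖(max 1 ‖x‖)⁻¹ • x - y‖ ≤ 2 * ‖x - y‖ := by
  have hm : 0 < max 1 ‖x‖ := lt_max_of_lt_left one_pos
  have h1 : ‖(max 1 ‖x‖)⁻¹ • x - x‖ ≤ ‖x - y‖ := by
    rcases le_total ‖x‖ 1 with h | h
    · rw [max_eq_left h]
      simp
    · rw [max_eq_right h] at hm ⊢
      have h2 : (‖x‖)⁻¹ • x - x = ((‖x‖)⁻¹ - 1) • x := by rw [sub_smul, one_smul]
      have h3 : (‖x‖)⁻¹ - 1 ≤ 0 := sub_nonpos.2 (inv_le_one_of_one_le₀ h)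
      rw [h2, norm_smul, Real.norm_eq_abs, abs_of_nonpos h3, neg_mul, sub_mul,
        inv_mul_cancel₀ hm.ne']
      linarith [norm_sub_norm_le x y]
  calc ‖(max 1 ‖x‖)⁻¹ • x - y‖ = ‖((max 1 ‖x‖)⁻¹ • x - x) + (x - y)‖ := by congr 1; abel
    _ ≤ ‖(max 1 ‖x‖)⁻¹ • x - x‖ + ‖x - y‖ := norm_add_le _ _
    _ ≤ 2 * ‖x - y‖ := by linarith

theorem norm_retraction_le {F : Type*} [NormedAddCommGroup F] [NormedSpace ℝ F] (x : F) :
    ‖(max 1 ‖x‖)⁻¹ • x‖ ≤ 1 := by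
  have hm : 0 < max 1 ‖x‖ := lt_max_of_lt_left one_pos
  rw [norm_smul, norm_inv, Real.norm_of_nonneg hm.le, inv_mul_le_iff₀ hm, mul_one]
  exact le_max_right _ _

/-- Density of continuous functions in `L¹(|μ|)`; the radial retraction restores the bound `1` at
the cost of a factor `2` in the error. -/
theorem exists_continuousMap_approx (μ : VecMeas S) {ψ : S → EuclideanSpace ℝ (Fin N)}
    (hψ : StronglyMeasurable ψ) (hψ1 : ∀ x, ‖ψ x‖ ≤ 1) {ε : ℝ} (hε : 0 < ε) :
    ∃ φ : C(S, EuclideanSpace ℝ (Fin N)), (∀ x, ‖φ x‖ ≤ 1) ∧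
      ∫ x, ‖φ x - ψ x‖ ∂μ.variation ≤ ε := by
  have hint : Integrable ψ μ.variation :=
    Integrable.of_bound hψ.aestronglyMeasurable 1 (Eventually.of_forall hψ1)
  obtain ⟨g, hg, hgi⟩ := hint.exists_boundedContinuous_integral_sub_le (half_pos hε)
  refine ⟨⟨fun x => (max 1 ‖g x‖)⁻¹ • g x, ?_⟩, fun x => norm_retraction_le _, ?_⟩
  · have hc : Continuous fun x => max 1 ‖g x‖ := continuous_const.max g.continuous.norm
    exact (hc.inv₀ fun x => (lt_max_of_lt_left one_pos).ne').smul g.continuous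
  · calc ∫ x, ‖(max 1 ‖g x‖)⁻¹ • g x - ψ x‖ ∂μ.variation
        ≤ ∫ x, 2 * ‖ψ x - g x‖ ∂μ.variation := by
          refine integral_mono_of_nonneg (Eventually.of_forall fun _ => norm_nonneg _)
            ((hint.sub hgi).norm.const_mul 2) (Eventually.of_forall fun x => ?_)
          dsimp only
          rw [norm_sub_rev (ψ x)]
          exact norm_retraction_sub_le _ _ (hψ1 x)
      _ ≤ ε := by
          rw [integral_const_mul]
          linarith

theorem abs_integral_sub_pairing_le (μ : VecMeas S) {ψ : S → EuclideanSpace ℝ (Fin N)}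
    (hψ : μ.Integrable ψ) (φ : C(S, EuclideanSpace ℝ (Fin N))) :
    |μ.integral ψ (innerSL ℝ) - pairing S μ φ| ≤ ∫ x, ‖φ x - ψ x‖ ∂μ.variation := by
  rw [pairing_apply, ← VectorMeasure.integral_sub hψ (integrable_continuousMap μ φ),
    ← Real.norm_eq_abs]
  refine VectorMeasure.norm_integral_le_integral_norm.trans ?_
  refine (mul_le_of_le_one_left (integral_nonneg fun _ => norm_nonneg _)
    (norm_innerSL_le _)).trans ?_
  refine le_of_eq (integral_congr_ae (Eventually.of_forall fun x => ?_))
  exact norm_sub_rev _ _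

/-- The total variation norm is at most the norm as a functional on continuous functions. -/
theorem tvNorm_le_of_pairing_le (μ : VecMeas S) {c : ℝ}
    (h : ∀ φ : C(S, EuclideanSpace ℝ (Fin N)), (∀ x, ‖φ x‖ ≤ 1) → pairing S μ φ ≤ c) :
    tvNorm μ ≤ c := by
  refine le_of_forall_pos_le_add fun ε hε => ?_
  obtain ⟨δ, hδ⟩ : ∃ δ : NNReal, (δ : ℝ) = ε / 2 := ⟨⟨ε / 2, (half_pos hε).le⟩, rfl⟩
  obtain ⟨P, -, hPd, hPm, hP⟩ := μ.exists_variation_le_add (s := Set.univ) MeasurableSet.univ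
    (ε := δ) (NNReal.coe_pos.1 (hδ ▸ half_pos hε)) (measure_ne_top _ _)
  have hPfin : ∑ p ∈ P, ‖μ p‖ₑ ≠ ∞ := ENNReal.sum_ne_top.2 fun _ _ => enorm_ne_top
  have hP' : tvNorm μ ≤ ∑ p ∈ P, ‖μ p‖ + ε / 2 := by
    have := ENNReal.toReal_mono (ENNReal.add_ne_top.2 ⟨hPfin, ENNReal.coe_ne_top⟩) hP
    rw [ENNReal.toReal_add hPfin ENNReal.coe_ne_top,
      ENNReal.toReal_sum (fun _ _ => enorm_ne_top), ENNReal.coe_toReal, hδ] at this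
    simpa [tvNorm] using this
  -- The direction of `μ p`, so that `⟨u p, μ p⟩ = ‖μ p‖`; when `μ p = 0` the convention `0⁻¹ = 0`
  -- gives `u p = 0`.
  set u : Set S → EuclideanSpace ℝ (Fin N) := fun p => (‖μ p‖)⁻¹ • μ p with hu
  have hu1 : ∀ p, ‖u p‖ ≤ 1 := fun p => by
    rw [hu, norm_smul, norm_inv, norm_norm]
    exact inv_mul_le_one
  set ψ : S → EuclideanSpace ℝ (Fin N) := fun x => ∑ p ∈ P, p.indicator (fun _ => u p) x with hψ
  have hψm : StronglyMeasurable ψ :=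
    Finset.stronglyMeasurable_fun_sum _ fun p hp =>
      stronglyMeasurable_const.indicator (hPm p hp)
  have hψ1 : ∀ x, ‖ψ x‖ ≤ 1 := fun x => by
    by_cases hx : ∃ p ∈ P, x ∈ p
    · obtain ⟨p, hp, hxp⟩ := hx
      have : ψ x = u p := by
        rw [hψ]
        dsimp only
        rw [Finset.sum_eq_single_of_mem p hp, Set.indicator_of_mem hxp]
        intro q hq hqp
        refine Set.indicator_of_notMem (fun hxq => ?_) _
        exact Set.disjoint_left.1 (hPd hq hp hqp) hxq hxp
      rw [this]
      exact hu1 p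
    · push Not at hx
      have : ψ x = 0 := Finset.sum_eq_zero fun p hp => Set.indicator_of_notMem (hx p hp) _
      rw [this]
      simp
  have hψi : μ.Integrable ψ :=
    Integrable.of_bound hψm.aestronglyMeasurable 1 (Eventually.of_forall hψ1)
  have hψint : μ.integral ψ (innerSL ℝ) = ∑ p ∈ P, ‖μ p‖ := by
    rw [hψ, VectorMeasure.integral_finsetSum]
    · refine Finset.sum_congr rfl fun p hp => ?_
      rw [integral_indicator_inner μ (hPm p hp), hu]
      dsimp only
      rw [real_inner_smul_left, real_inner_self_eq_norm_mul_norm]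
      rcases eq_or_ne ‖μ p‖ 0 with h0 | h0
      · simp [h0]
      · field_simp
    · intro p hp
      exact (integrable_const (u p)).indicator (hPm p hp)
  obtain ⟨φ, hφ1, hφ⟩ := exists_continuousMap_approx μ hψm hψ1 (half_pos hε)
  have h3 := (abs_le.1 ((abs_integral_sub_pairing_le μ hψi φ).trans hφ)).2
  have h4 := h φ hφ1
  rw [hψint] at h3
  linarith

/-- If `μ` annihilates the continuous functions vanishing off a ball, then `|μ|` vanishes on the
ball of half the radius. -/
theorem variation_ball_half_eq_zero (μ : VecMeas S) (x₀ : S) {r : ℝ} (hr : 0 < r)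
    (h : ∀ φ : C(S, EuclideanSpace ℝ (Fin N)), (∀ x ∉ Metric.ball x₀ r, φ x = 0) →
      pairing S μ φ = 0) : μ.variation (Metric.ball x₀ (r / 2)) = 0 := by
  rw [VectorMeasure.variation_apply_eq_zero Metric.isOpen_ball.measurableSet]
  intro B hBs hB
  -- Cutoff equal to `1` on the half ball and `0` off the ball. Since `B` lies in the half ball,
  -- multiplying an approximant of the indicator of `B` by `χ` does not increase its error.
  let χ : S → ℝ := fun x => max 0 (min 1 (2 - 2 * dist x x₀ / r))
  have hχc : Continuous χ := by fun_prop
  have hχ1 : ∀ x, ‖χ x‖ ≤ 1 := fun x => by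
    rw [Real.norm_of_nonneg (le_max_left _ _)]
    exact max_le zero_le_one (min_le_left _ _)
  have hχB : ∀ x ∈ B, χ x = 1 := fun x hx => by
    have h1 : dist x x₀ < r / 2 := hBs hx
    have h2 : 2 * dist x x₀ / r ≤ 1 := by
      rw [div_le_one hr]
      linarith
    have h3 : min 1 (2 - 2 * dist x x₀ / r) = 1 := min_eq_left (by linarith)
    simp only [χ, h3]
    norm_num
  have hχ0 : ∀ x ∉ Metric.ball x₀ r, χ x = 0 := fun x hx => by
    have h1 : r ≤ dist x x₀ := not_lt.1 hx
    have h2 : 2 ≤ 2 * dist x x₀ / r := by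
      rw [le_div_iff₀ hr]
      linarith
    exact max_eq_left ((min_le_right _ _).trans (by linarith))
  have key : ∀ v : EuclideanSpace ℝ (Fin N), ‖v‖ ≤ 1 → inner ℝ v (μ B) = 0 := by
    intro v hv
    have hψm : StronglyMeasurable (B.indicator fun _ : S => v) :=
      stronglyMeasurable_const.indicator hB
    have hψ1 : ∀ x, ‖B.indicator (fun _ : S => v) x‖ ≤ 1 := fun x =>
      (norm_indicator_le_norm_self _ _).trans hv
    have hψi : μ.Integrable (B.indicator fun _ : S => v) := (integrable_const v).indicator hB
    rw [← integral_indicator_inner μ hB]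
    refine abs_eq_zero.1 (le_antisymm (le_of_forall_pos_le_add fun ε hε => ?_) (abs_nonneg _))
    obtain ⟨φ, -, hφ⟩ := exists_continuousMap_approx μ hψm hψ1 hε
    let φ' : C(S, EuclideanSpace ℝ (Fin N)) := ⟨fun x => χ x • φ x, hχc.smul φ.continuous⟩
    have h0 : pairing S μ φ' = 0 := h φ' fun x hx => by simp [φ', hχ0 x hx]
    have h1 := abs_integral_sub_pairing_le μ hψi φ'
    rw [h0, sub_zero] at h1
    rw [zero_add]
    refine h1.trans (le_trans ?_ hφ)
    refine integral_mono_of_nonneg (Eventually.of_forall fun _ => norm_nonneg _)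
      (((integrable_continuousMap μ φ).sub hψi).norm) (Eventually.of_forall fun x => ?_)
    have h2 : φ' x - B.indicator (fun _ => v) x = χ x • (φ x - B.indicator (fun _ => v) x) := by
      by_cases hx : x ∈ B
      · simp [φ', hx, hχB x hx]
      · simp [φ', hx]
    dsimp only
    rw [h2, norm_smul]
    exact mul_le_of_le_one_left (norm_nonneg _) (hχ1 x)
  have h5 := key ((‖μ B‖)⁻¹ • μ B) (by
    rw [norm_smul, norm_inv, norm_norm]
    exact inv_mul_le_one)
  rw [real_inner_smul_left, real_inner_self_eq_norm_mul_norm] at h5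
  by_contra h6
  have h7 : ‖μ B‖ ≠ 0 := norm_ne_zero_iff.2 h6
  field_simp at h5
  exact h7 h5

end Density

/-! ### Weak-star compactness and lower semicontinuity -/

section Compactness

variable {N : ℕ} {S : Set (EuclideanSpace ℝ (Fin N))} [CompactSpace S]

theorem pairing_ofMeasure_single (ν : Measure S) [IsFiniteMeasure ν] (i : Fin N)
    (φ : C(S, EuclideanSpace ℝ (Fin N))) :
    pairing S (ofMeasure ν (EuclideanSpace.single i 1)) φ = ∫ x, φ x i ∂ν := by
  rw [pairing_ofMeasure]
  refine integral_congr_ae (Eventually.of_forall fun x => ?_)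
  simp [EuclideanSpace.inner_single_right]

theorem tendsto_pairing_ofMeasure {ι : Type*} {l : Filter ι} {ν : ι → FiniteMeasure S}
    {ν₀ : FiniteMeasure S} (h : Tendsto ν l (𝓝 ν₀)) (i : Fin N)
    (φ : C(S, EuclideanSpace ℝ (Fin N))) :
    Tendsto (fun n => pairing S (ofMeasure (ν n : Measure S) (EuclideanSpace.single i 1)) φ) l
      (𝓝 (pairing S (ofMeasure (ν₀ : Measure S) (EuclideanSpace.single i 1)) φ)) := by
  simp_rw [pairing_ofMeasure_single]
  have hc : Continuous fun x => φ x i := by fun_prop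
  exact FiniteMeasure.tendsto_iff_forall_integral_tendsto.1 h
    (BoundedContinuousFunction.mkOfCompact ⟨fun x => φ x i, hc⟩)

/-- Along an ultrafilter, a family that is bounded in total variation converges weak-star. -/
theorem exists_tendsto_pairing {ι : Type*} (U : Ultrafilter ι) {m : ι → VecMeas S} {c : ℝ}
    (hm : ∀ n, tvNorm (m n) ≤ c) :
    ∃ μ : VecMeas S, ∀ φ, Tendsto (fun n => pairing S (m n) φ) U (𝓝 (pairing S μ φ)) := by
  have hK := isCompact_setOfPred_finiteMeasure_le_of_compactSpace S c.toNNReal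
  have hlim : ∀ ν : ι → FiniteMeasure S, (∀ n, (ν n).mass ≤ c.toNNReal) →
      ∃ ν₀, Tendsto ν U (𝓝 ν₀) := fun ν hν => by
    obtain ⟨ν₀, -, h⟩ := hK.ultrafilter_le_nhds (U.map ν)
      (le_principal_iff.2 (Ultrafilter.mem_map.2 (Filter.univ_mem' hν)))
    exact ⟨ν₀, h⟩
  choose P hP using fun i => hlim (fun n => coordPos (m n) i) fun n =>
    (mass_coordPos_le (m n) i).trans (Real.toNNReal_le_toNNReal (hm n))
  choose Q hQ using fun i => hlim (fun n => coordNeg (m n) i) fun n =>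
    (mass_coordNeg_le (m n) i).trans (Real.toNNReal_le_toNNReal (hm n))
  refine ⟨∑ i, (ofMeasure (P i : Measure S) (EuclideanSpace.single i 1)
      - ofMeasure (Q i : Measure S) (EuclideanSpace.single i 1)), fun φ => ?_⟩
  have h1 : ∀ n, pairing S (m n) φ
      = ∑ i, (pairing S (ofMeasure (coordPos (m n) i : Measure S) (EuclideanSpace.single i 1)) φ
        - pairing S (ofMeasure (coordNeg (m n) i : Measure S) (EuclideanSpace.single i 1)) φ) :=
    fun n => by
      conv_lhs => rw [eq_sum_ofMeasure_coord (m n)]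
      simp only [map_sum, map_sub, LinearMap.sum_apply, LinearMap.sub_apply]
  simp_rw [h1]
  simp only [map_sum, map_sub, LinearMap.sum_apply, LinearMap.sub_apply]
  exact tendsto_finsetSum _ fun i _ =>
    (tendsto_pairing_ofMeasure (hP i) i φ).sub (tendsto_pairing_ofMeasure (hQ i) i φ)

/-- The total variation norm is weak-star lower semicontinuous. -/
theorem tvNorm_le_of_tendsto {ι : Type*} {l : Filter ι} [l.NeBot] {m : ι → VecMeas S}
    {μ : VecMeas S} {c : ℝ}
    (h : ∀ φ, Tendsto (fun n => pairing S (m n) φ) l (𝓝 (pairing S μ φ)))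
    (hc : Tendsto (fun n => tvNorm (m n)) l (𝓝 c)) : tvNorm μ ≤ c := by
  refine tvNorm_le_of_pairing_le μ fun φ hφ => ?_
  refine le_of_tendsto_of_tendsto (h φ) hc (Eventually.of_forall fun n => ?_)
  refine (le_abs_self _).trans ?_
  simpa using abs_pairing_le_of_ae (m n) φ (Eventually.of_forall hφ)

end Compactness

/-! ### Optimality conditions and the dual certificate -/

section Optimality

variable {N : ℕ} {S : Set (EuclideanSpace ℝ (Fin N))}
  {H : Type*} [NormedAddCommGroup H] [InnerProductSpace ℝ H]
  {A : VecMeas S →ₗ[ℝ] H} {lam : ℝ} {f : H} {V : Submodule ℝ (VecMeas S)} {μ : VecMeas S}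

/-- The first order optimality condition for minimizers. -/
theorem IsMinimizer.variational_inequality (hlam : 0 < lam) (hμ : IsMinimizer A lam f V μ)
    {ξ : VecMeas S} (hξ : ξ ∈ V) :
    2 * inner ℝ (f - A μ) (A ξ - A μ) ≤ lam * (tvNorm ξ - tvNorm μ) := by
  set r := f - A μ with hr
  set d := A ξ - A μ with hd
  -- Compare `μ` with the segment point `(1 - t)μ + tξ`, use convexity of the norm and divide by
  -- `t`; then `t → 0⁺`.
  have key : ∀ t : ℝ, 0 < t → t ≤ 1 →
      2 * inner ℝ r d - lam * (tvNorm ξ - tvNorm μ) ≤ t * ‖d‖ ^ 2 := by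
    intro t ht ht1
    have h1 := hμ.2 ((1 - t) • μ + t • ξ) (V.add_mem (V.smul_mem _ hμ.1) (V.smul_mem _ hξ))
    have h2 : tvNorm ((1 - t) • μ + t • ξ) ≤ (1 - t) * tvNorm μ + t * tvNorm ξ := by
      refine (tvNorm_add_le _ _).trans (le_of_eq ?_)
      rw [tvNorm_smul, tvNorm_smul, abs_of_nonneg (sub_nonneg.2 ht1), abs_of_pos ht]
    have h3 : f - A ((1 - t) • μ + t • ξ) = r - t • d := by
      rw [map_add, map_smul, map_smul, hr, hd, sub_smul, one_smul, smul_sub]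
      abel
    have h4 : ‖r - t • d‖ ^ 2 = ‖r‖ ^ 2 - 2 * (t * inner ℝ r d) + t ^ 2 * ‖d‖ ^ 2 := by
      rw [norm_sub_sq_real, real_inner_smul_right, norm_smul, mul_pow, Real.norm_eq_abs, sq_abs]
    rw [objective, objective, h3, h4] at h1
    have h5 := mul_le_mul_of_nonneg_left h2 hlam.le
    have h6 : t * (2 * inner ℝ r d - lam * (tvNorm ξ - tvNorm μ)) ≤ t * (t * ‖d‖ ^ 2) := by
      linarith
    exact le_of_mul_le_mul_left h6 ht
  have hlim : Tendsto (fun t : ℝ => t * ‖d‖ ^ 2) (𝓝[>] 0) (𝓝 (0 * ‖d‖ ^ 2)) :=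
    ((continuous_id.mul continuous_const).tendsto 0).mono_left nhdsWithin_le_nhds
  have h7 : 2 * inner ℝ r d - lam * (tvNorm ξ - tvNorm μ) ≤ 0 * ‖d‖ ^ 2 := by
    refine ge_of_tendsto hlim ?_
    filter_upwards [Ioc_mem_nhdsGT (zero_lt_one' ℝ)] with t ht using key t ht.1 ht.2
  linarith

/-- Expanding the square around `f - Aμ` leaves exactly `‖Aξ - Aμ‖²` plus terms that are nonnegative
by the first order condition. -/
theorem IsMinimizer.sq_norm_sub_le (hlam : 0 < lam) (hμ : IsMinimizer A lam f V μ)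
    {ξ : VecMeas S} (hξ : ξ ∈ V) :
    ‖A ξ - A μ‖ ^ 2 ≤ objective A lam f ξ - objective A lam f μ := by
  have h := hμ.variational_inequality hlam hξ
  have h1 : f - A ξ = (f - A μ) - (A ξ - A μ) := by abel
  rw [objective, objective, h1, norm_sub_sq_real (f - A μ)]
  linarith

variable [CompactSpace S]

theorem IsMinimizer.pairing_le (hA : IsWeakStarContinuous A) (hlam : 0 < lam)
    (hμ : IsMinimizer A lam f V μ) {η : VecMeas S} (hη : η ∈ V) :
    pairing S η (adjoint hA (f - A μ)) ≤ lam / 2 * tvNorm η := by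
  have h := hμ.variational_inequality hlam (V.add_mem hμ.1 hη)
  rw [map_add, add_sub_cancel_left] at h
  rw [pairing_adjoint]
  have h1 := mul_le_mul_of_nonneg_left (tvNorm_add_le μ η) hlam.le
  linarith

/-- Removing the part of `μ` on `B` lowers the norm by exactly `|μ|(B)`. This localizes optimality
to any `B` whose restriction stays in `V`. -/
theorem IsMinimizer.le_pairing_restrict (hA : IsWeakStarContinuous A) (hlam : 0 < lam)
    (hμ : IsMinimizer A lam f V μ) {B : Set S} (hB : MeasurableSet B) (hμB : μ.restrict B ∈ V) :
    lam / 2 * μ.variation.real B ≤ pairing S (μ.restrict B) (adjoint hA (f - A μ)) := by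
  have h := hμ.variational_inequality hlam (V.sub_mem hμ.1 hμB)
  have h1 : μ - μ.restrict B = μ.restrict Bᶜ :=
    sub_eq_of_eq_add' (VectorMeasure.restrict_add_restrict_compl hB).symm
  have h2 := tvNorm_restrict_add_compl μ hB
  rw [tvNorm_restrict μ hB] at h2
  rw [map_sub, sub_sub_cancel_left, inner_neg_right, h1] at h
  rw [pairing_adjoint]
  have h3 : lam * (tvNorm (μ.restrict Bᶜ) - tvNorm μ) = - (lam * μ.variation.real B) := by
    rw [← h2]
    ring
  linarith

/-- Tested with the Dirac mass at `x` in the direction of the certificate. -/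
theorem IsMinimizer.norm_adjoint_le (hA : IsWeakStarContinuous A) (hlam : 0 < lam)
    (hμ : IsMinimizer A lam f ⊤ μ) (x : S) : ‖adjoint hA (f - A μ) x‖ ≤ lam / 2 := by
  set p := adjoint hA (f - A μ) with hp
  have h := hμ.pairing_le hA hlam (η := VectorMeasure.dirac x (p x)) Submodule.mem_top
  rw [← hp, pairing_dirac, tvNorm_dirac, real_inner_self_eq_norm_mul_norm] at h
  rcases eq_or_ne ‖p x‖ 0 with h0 | h0
  · rw [h0]
    positivity
  · exact le_of_mul_le_mul_right h (lt_of_le_of_ne (norm_nonneg _) h0.symm)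

theorem abs_pairing_restrict_le (μ : VecMeas S) (φ : C(S, EuclideanSpace ℝ (Fin N))) {B : Set S}
    (hB : MeasurableSet B) {c : ℝ} (h : ∀ x ∈ B, ‖φ x‖ ≤ c) :
    |pairing S (μ.restrict B) φ| ≤ c * μ.variation.real B := by
  rw [← tvNorm_restrict μ hB]
  refine abs_pairing_le_of_ae _ _ ?_
  rw [VectorMeasure.variation_restrict hB]
  exact ae_restrict_of_forall_mem hB h

/-- On the support of a minimizer the dual certificate is almost of maximal norm. -/
theorem IsMinimizer.le_norm_adjoint_of_mem_supp (hA : IsWeakStarContinuous A) (hlam : 0 < lam)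
    (hμ : IsMinimizer A lam f V μ) {ι : Type*} [Countable ι] {E : ι → Set S}
    (hEm : ∀ k, MeasurableSet (E k)) (hEU : ⋃ k, E k = Set.univ)
    (hEV : ∀ k, μ.restrict (E k) ∈ V) {δ : ℝ}
    (hδ : ∀ k, ∀ y ∈ E k, ∀ z ∈ E k,
      dist (adjoint hA (f - A μ) y) (adjoint hA (f - A μ) z) ≤ δ)
    {x : S} (hx : x ∈ μ.supp) : lam / 2 - δ ≤ ‖adjoint hA (f - A μ) x‖ := by
  set p := adjoint hA (f - A μ) with hp
  by_contra! hlt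
  set U : Set S := {y | ‖p y‖ < lam / 2 - δ} with hU
  have hUo : IsOpen U := isOpen_lt p.continuous.norm continuous_const
  have hpos := (Measure.mem_support_iff_forall x).1 hx U (hUo.mem_nhds hlt)
  -- The neighbourhood `U` is covered by the cells that meet it, and each of these is `|μ|`-null:
  -- its mass `m` satisfies `(λ/2) m ≤ (‖p y‖ + δ) m` with `‖p y‖ + δ < λ/2`.
  refine hpos.ne' (measure_mono_null (t := ⋃ k, ⋃ _ : (E k ∩ U).Nonempty, E k) ?_ ?_)
  · intro y hy
    obtain ⟨k, hk⟩ := Set.mem_iUnion.1 (hEU.symm ▸ Set.mem_univ y)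
    exact Set.mem_iUnion₂.2 ⟨k, ⟨y, hk, hy⟩, hk⟩
  · refine measure_iUnion_null fun k => measure_iUnion_null fun ⟨y, hyE, hyU⟩ => ?_
    have h1 := hμ.le_pairing_restrict hA hlam (hEm k) (hEV k)
    have h2 := (le_abs_self _).trans
      (abs_pairing_restrict_le μ p (hEm k) (c := ‖p y‖ + δ) fun z hz => by
        have := hδ k z hz y hyE
        rw [dist_eq_norm] at this
        linarith [norm_sub_norm_le (p z) (p y)])
    have h3 : ‖p y‖ < lam / 2 - δ := hyU
    have h4 : 0 ≤ μ.variation.real (E k) := measureReal_nonneg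
    have h5 : μ.variation.real (E k) = 0 := by
      rw [← hp] at h1
      nlinarith
    exact (measureReal_eq_zero_iff).1 h5

end Optimality

/-! ### Boundedness of the adjoint -/

section Adjoint

variable {N : ℕ} {S : Set (EuclideanSpace ℝ (Fin N))} [CompactSpace S]
  {H : Type*} [NormedAddCommGroup H] [InnerProductSpace ℝ H]
  {A : VecMeas S →ₗ[ℝ] H}

theorem adjoint_sub (hA : IsWeakStarContinuous A) (g h : H) :
    adjoint hA (g - h) = adjoint hA g - adjoint hA h := by
  refine (adjoint_unique hA _ _ fun μ => ?_).symm
  rw [map_sub, pairing_adjoint, pairing_adjoint, inner_sub_left]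

theorem inner_adjoint_apply (hA : IsWeakStarContinuous A) (g : H) (x : S)
    (v : EuclideanSpace ℝ (Fin N)) :
    inner ℝ (adjoint hA g x) v = inner ℝ g (A (VectorMeasure.dirac x v)) := by
  rw [← pairing_dirac, pairing_adjoint]

/-- Uniform boundedness applied to the functionals `⟨A(v δₓ), ·⟩` with `|v| ≤ 1`: at each `g` they
are bounded by `‖A^* g‖`, and their supremum over `x` and `v` is that norm. -/
theorem exists_norm_adjoint_le [CompleteSpace H] (hA : IsWeakStarContinuous A) :
    ∃ M : ℝ, ∀ g, ‖adjoint hA g‖ ≤ M * ‖g‖ := by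
  obtain ⟨M, hM⟩ := banach_steinhaus
    (g := fun i : S × Metric.closedBall (0 : EuclideanSpace ℝ (Fin N)) 1 =>
      innerSL ℝ (A (VectorMeasure.dirac i.1 (i.2 : EuclideanSpace ℝ (Fin N))))) (by
    intro g
    refine ⟨‖adjoint hA g‖, fun i => ?_⟩
    rw [innerSL_apply_apply, real_inner_comm, ← inner_adjoint_apply hA]
    have h1 : ‖(i.2 : EuclideanSpace ℝ (Fin N))‖ ≤ 1 := mem_closedBall_zero_iff.1 i.2.2
    calc ‖inner ℝ (adjoint hA g i.1) (i.2 : EuclideanSpace ℝ (Fin N))‖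
        ≤ ‖adjoint hA g i.1‖ * ‖(i.2 : EuclideanSpace ℝ (Fin N))‖ := norm_inner_le_norm _ _
      _ ≤ ‖adjoint hA g‖ * 1 := by
        gcongr
        exact (adjoint hA g).norm_coe_le_norm _
      _ = _ := mul_one _)
  refine ⟨max M 0, fun g => ?_⟩
  rw [ContinuousMap.norm_le _ (by positivity)]
  intro x
  set w := adjoint hA g x with hw
  have hu : (‖w‖)⁻¹ • w ∈ Metric.closedBall (0 : EuclideanSpace ℝ (Fin N)) 1 := by
    rw [mem_closedBall_zero_iff, norm_smul, norm_inv, norm_norm]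
    exact inv_mul_le_one
  have h1 : inner ℝ w ((‖w‖)⁻¹ • w) = ‖w‖ := by
    rw [real_inner_smul_right, real_inner_self_eq_norm_mul_norm]
    rcases eq_or_ne ‖w‖ 0 with h0 | h0
    · simp [h0]
    · field_simp
  have h2 := (innerSL ℝ (A (VectorMeasure.dirac x ((‖w‖)⁻¹ • w)))).le_of_opNorm_le
    ((hM (x, ⟨_, hu⟩)).trans (le_max_left M 0)) g
  rw [innerSL_apply_apply, real_inner_comm, ← inner_adjoint_apply hA, ← hw, h1, norm_norm] at h2
  exact h2

theorem tendsto_adjoint [CompleteSpace H] (hA : IsWeakStarContinuous A) {ι : Type*} {l : Filter ι}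
    {g : ι → H} {g₀ : H} (h : Tendsto g l (𝓝 g₀)) :
    Tendsto (fun n => adjoint hA (g n)) l (𝓝 (adjoint hA g₀)) := by
  obtain ⟨M, hM⟩ := exists_norm_adjoint_le hA
  rw [tendsto_iff_norm_sub_tendsto_zero] at h ⊢
  refine squeeze_zero (fun _ => norm_nonneg _) (fun n => ?_) (by simpa using h.const_mul M)
  rw [← adjoint_sub]
  exact hM _

end Adjoint

/-! ### GSM spaces: restriction to cells and weak approximation -/

section Gsm

variable {N : ℕ} {S : Set (EuclideanSpace ℝ (Fin N))} {I : Set ℕ} {ν : I → Measure S}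
  {E : I → Set S}

theorem ofMeasure_mem_gsmSpace [∀ k, IsProbabilityMeasure (ν k)] (k : I)
    (v : EuclideanSpace ℝ (Fin N)) : ofMeasure (ν k) v ∈ gsmSpace ν := by
  classical
  refine ⟨fun j => if j = k then v else 0, ?_, fun B hB => ?_⟩
  · exact (hasSum_single k fun j hj => by simp [hj]).summable
  · rw [ofMeasure_apply _ _ hB]
    have := hasSum_single (f := fun j => (ν j).real B • if j = k then v else 0) k
      fun j hj => by simp [hj]
    simpa using this

theorem IsCompatiblePartition.apply_compl [∀ k, IsProbabilityMeasure (ν k)]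
    (hE : IsCompatiblePartition ν E) (k : I) : ν k (E k)ᶜ = 0 :=
  (prob_compl_eq_zero_iff (hE.measurableSet k)).2 (hE.apply_self k)

/-- On `E k` every other generator vanishes and `ν k` has full mass there, so only the term `m k • ν
k` survives. -/
theorem IsCompatiblePartition.restrict_mem [∀ k, IsProbabilityMeasure (ν k)]
    (hE : IsCompatiblePartition ν E) {μ : VecMeas S} (hμ : μ ∈ gsmSpace ν) (k : I) :
    μ.restrict (E k) ∈ gsmSpace ν := by
  obtain ⟨m, -, hm⟩ := hμ
  have h : μ.restrict (E k) = ofMeasure (ν k) (m k) := by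
    ext1 B hB
    rw [VectorMeasure.restrict_apply _ (hE.measurableSet k) hB, ofMeasure_apply _ _ hB]
    have h1 := hasSum_single (f := fun j => (ν j).real (B ∩ E k) • m j) k fun j hj => by
      have h2 : (ν j).real (B ∩ E k) = 0 := by
        rw [measureReal_eq_zero_iff]
        exact measure_mono_null Set.inter_subset_right (hE.apply_ne k j hj.symm)
      rw [h2, zero_smul]
    rw [(hm _ (hB.inter (hE.measurableSet k))).unique h1]
    congr 1
    rw [measureReal_def, measureReal_def, measure_inter_conull (hE.apply_compl k)]
  rw [h]
  exact ofMeasure_mem_gsmSpace k _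

/-- Restricting to a large finite part of a countable partition loses little mass. -/
theorem exists_finset_variation_compl_le {ι : Type*} [Countable ι] (μ : VecMeas S) {E : ι → Set S}
    (hEm : ∀ k, MeasurableSet (E k)) (hEd : ∀ j k, j ≠ k → Disjoint (E j) (E k))
    (hEU : ⋃ k, E k = Set.univ) {ε : ℝ} (hε : 0 < ε) :
    ∃ F : Finset ι, μ.variation.real (⋃ k ∈ F, E k)ᶜ ≤ ε := by
  have h1 : μ.variation Set.univ = ∑' k, μ.variation (E k) := by
    rw [← hEU, measure_iUnion (fun j k hjk => hEd j k hjk) hEm]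
  have hfin : ∑' k, μ.variation (E k) ≠ ∞ := h1 ▸ measure_ne_top _ _
  have h2 : HasSum (fun k => μ.variation.real (E k)) (tvNorm μ) := by
    have h3 := ENNReal.hasSum_toReal hfin
    rw [← ENNReal.tsum_toReal_eq fun k => measure_ne_top _ _, ← h1] at h3
    exact h3
  obtain ⟨F, hF⟩ := (h2.eventually (lt_mem_nhds (sub_lt_self (tvNorm μ) hε))).exists
  refine ⟨F, ?_⟩
  have hm : MeasurableSet (⋃ k ∈ F, E k) := F.measurableSet_biUnion fun k _ => hEm k
  have h4 := measureReal_add_measureReal_compl (μ := μ.variation) hm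
  rw [measureReal_biUnion_finset (fun j _ k _ hjk => hEd j k hjk) fun k _ => hEm k,
    ← tvNorm_eq_real] at h4
  linarith

variable [CompactSpace S]

/-- Zero total mass allows subtracting from `φ` its value at a point of `B`, so only the oscillation
on `B` counts. -/
theorem abs_pairing_le_of_dist_le {η : VecMeas S} (h0 : η Set.univ = 0) {B : Set S}
    (hB : η.variation Bᶜ = 0) {φ : C(S, EuclideanSpace ℝ (Fin N))} {w : ℝ}
    (hw : ∀ x ∈ B, ∀ y ∈ B, dist (φ x) (φ y) ≤ w) : |pairing S η φ| ≤ w * tvNorm η := by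
  have hae : ∀ᵐ x ∂η.variation, x ∈ B := by rwa [← mem_ae_iff] at hB
  rcases B.eq_empty_or_nonempty with rfl | ⟨x₀, hx₀⟩
  · refine abs_pairing_le_of_ae η φ ?_
    filter_upwards [hae] with x hx using absurd hx (Set.notMem_empty x)
  · have h1 : pairing S η φ = pairing S η (φ - ContinuousMap.const S (φ x₀)) := by
      rw [map_sub, pairing_const, h0, inner_zero_right, sub_zero]
    rw [h1]
    refine abs_pairing_le_of_ae η _ ?_
    filter_upwards [hae] with x hx
    have := hw x hx x₀ hx₀
    rwa [dist_eq_norm] at this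

/-- Weak approximation of a measure by elements of a GSM space, not increasing the norm. -/
theorem IsCompatiblePartition.exists_abs_pairing_sub_le (hν : IsGeneratingFamily ν)
    (hE : IsCompatiblePartition ν E) (μ : VecMeas S) {φ : C(S, EuclideanSpace ℝ (Fin N))} {w : ℝ}
    (hw0 : 0 < w) (hw : ∀ k, ∀ x ∈ E k, ∀ y ∈ E k, dist (φ x) (φ y) ≤ w) :
    ∃ η ∈ gsmSpace ν, tvNorm η ≤ tvNorm μ ∧
      |pairing S μ φ - pairing S η φ| ≤ w * (2 * tvNorm μ + ‖φ‖) := by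
  have := hν.isProbabilityMeasure
  obtain ⟨F, hF⟩ := exists_finset_variation_compl_le μ hE.measurableSet hE.disjoint hE.iUnion_eq
    hw0
  have hm : MeasurableSet (⋃ k ∈ F, E k) := F.measurableSet_biUnion fun k _ => hE.measurableSet k
  have hsum : ∑ k ∈ F, μ.variation.real (E k) ≤ tvNorm μ := by
    rw [← measureReal_biUnion_finset (fun j _ k _ hjk => hE.disjoint j k hjk)
      fun k _ => hE.measurableSet k, tvNorm_eq_real]
    exact measureReal_mono (Set.subset_univ _)
  have hone : ∀ k, tvNorm (ofMeasure (ν k) (μ (E k))) ≤ μ.variation.real (E k) := fun k => by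
    refine (tvNorm_ofMeasure_le _ _).trans ?_
    rw [probReal_univ, one_mul]
    exact VectorMeasure.norm_measure_le_variation (measure_ne_top _ _)
  refine ⟨∑ k ∈ F, ofMeasure (ν k) (μ (E k)),
    Submodule.sum_mem _ fun k _ => ofMeasure_mem_gsmSpace k _,
    (tvNorm_sum_le _ _).trans ((Finset.sum_le_sum fun k _ => hone k).trans hsum), ?_⟩
  -- The error splits into a tail of mass at most `w` and, on each cell of `F`, a measure of zero
  -- total mass carried by that cell.
  have hdec : μ - ∑ k ∈ F, ofMeasure (ν k) (μ (E k))
      = μ.restrict (⋃ k ∈ F, E k)ᶜ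
        + ∑ k ∈ F, (μ.restrict (E k) - ofMeasure (ν k) (μ (E k))) := by
    have h1 : μ.restrict (⋃ k ∈ F, E k) = ∑ k ∈ F, μ.restrict (E k) := by
      ext1 B hB
      rw [VectorMeasure.restrict_apply _ hm hB, Set.inter_iUnion₂,
        VectorMeasure.of_biUnion_finset]
      · rw [FunLike.coe_sum, Finset.sum_apply]
        exact Finset.sum_congr rfl fun k _ =>
          (VectorMeasure.restrict_apply _ (hE.measurableSet k) hB).symm
      · exact fun j _ k _ hjk =>
          (hE.disjoint j k hjk).mono Set.inter_subset_right Set.inter_subset_right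
      · exact fun k _ => hB.inter (hE.measurableSet k)
    rw [Finset.sum_sub_distrib, ← h1]
    nth_rw 1 [← VectorMeasure.restrict_add_restrict_compl (v := μ) hm]
    abel
  have hterm : ∀ k, |pairing S (μ.restrict (E k) - ofMeasure (ν k) (μ (E k))) φ|
      ≤ w * (2 * μ.variation.real (E k)) := fun k => by
    set η := μ.restrict (E k) - ofMeasure (ν k) (μ (E k)) with hη
    have h0 : η Set.univ = 0 := by
      rw [hη, sub_apply, VectorMeasure.restrict_apply_univ,
        ofMeasure_apply _ _ MeasurableSet.univ, probReal_univ, one_smul, sub_self]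
    have h1 : η.variation (E k)ᶜ = 0 := by
      refine le_antisymm ((VectorMeasure.variation_sub_le _).trans ?_) zero_le
      rw [Measure.add_apply, VectorMeasure.variation_restrict (hE.measurableSet k),
        Measure.restrict_apply (hE.measurableSet k).compl, Set.compl_inter_self, measure_empty,
        zero_add]
      refine (variation_ofMeasure_le _ _ _).trans ?_
      rw [Measure.smul_apply, hE.apply_compl k, smul_zero]
    refine (abs_pairing_le_of_dist_le h0 h1 (hw k)).trans ?_
    gcongr
    rw [hη, sub_eq_add_neg]
    refine (tvNorm_add_le _ _).trans ?_
    rw [tvNorm_neg, tvNorm_restrict μ (hE.measurableSet k)]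
    linarith [hone k]
  rw [← LinearMap.sub_apply, ← map_sub, hdec, map_add, LinearMap.add_apply, map_sum,
    LinearMap.sum_apply]
  calc _ ≤ ‖φ‖ * w + ∑ k ∈ F, w * (2 * μ.variation.real (E k)) := by
        refine (abs_add_le _ _).trans (add_le_add ?_ ?_)
        · refine (abs_pairing_le _ _).trans ?_
          rw [tvNorm_restrict μ hm.compl]
          gcongr
        · exact (Finset.abs_sum_le_sum_abs _ _).trans (Finset.sum_le_sum fun k _ => hterm k)
    _ ≤ _ := by
        rw [← Finset.mul_sum, ← Finset.mul_sum]
        nlinarith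

end Gsm

/-! ### Inclusions for Hausdorff cluster points -/

section HausdorffClusterPt

variable {N : ℕ} {S : Set (EuclideanSpace ℝ (Fin N))} {K : ℕ → Set S} {C L : Set S}

theorem IsHausdorffClusterPt.subset_of_tendsto (hC : IsHausdorffClusterPt K C) (hL : IsClosed L)
    (h : Tendsto (fun n => ⨆ x ∈ K n, Metric.infEDist x L) atTop (𝓝 0)) : C ⊆ L := by
  intro x hx
  rw [← hL.closure_eq, Metric.mem_closure_iff_infEDist_zero]
  refine le_antisymm (le_of_forall_pos_le_add fun ε hε => ?_) zero_le
  rw [zero_add]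
  have hε2 : 0 < ε / 2 := ENNReal.half_pos hε.ne'
  obtain ⟨n, hn1, hn2⟩ := ((hC _ hε2).and_eventually (ENNReal.tendsto_nhds_zero.1 h _ hε2)).exists
  rw [Metric.hausdorffEDist_comm] at hn1
  obtain ⟨y, hy, hxy⟩ := Metric.exists_edist_lt_of_hausdorffEDist_lt hx hn1
  calc Metric.infEDist x L ≤ Metric.infEDist y L + edist x y :=
        Metric.infEDist_le_infEDist_add_edist
    _ ≤ ε / 2 + ε / 2 :=
        add_le_add ((le_iSup₂ (f := fun x (_ : x ∈ K n) => Metric.infEDist x L) y hy).trans hn2)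
          hxy.le
    _ = ε := ENNReal.add_halves ε

theorem IsHausdorffClusterPt.superset_of_tendsto (hC : IsHausdorffClusterPt K C)
    (hCc : IsClosed C)
    (h : Tendsto (fun n => ⨆ x ∈ L, Metric.infEDist x (K n)) atTop (𝓝 0)) : L ⊆ C := by
  intro x hx
  rw [← hCc.closure_eq, Metric.mem_closure_iff_infEDist_zero]
  refine le_antisymm (le_of_forall_pos_le_add fun ε hε => ?_) zero_le
  rw [zero_add]
  have hε2 : 0 < ε / 2 := ENNReal.half_pos hε.ne'
  obtain ⟨n, hn1, hn2⟩ := ((hC _ hε2).and_eventually (ENNReal.tendsto_nhds_zero.1 h _ hε2)).exists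
  calc Metric.infEDist x C ≤ Metric.infEDist x (K n) + Metric.hausdorffEDist (K n) C :=
        Metric.infEDist_le_infEDist_add_hausdorffEDist
    _ ≤ ε / 2 + ε / 2 :=
        add_le_add ((le_iSup₂ (f := fun x (_ : x ∈ L) => Metric.infEDist x (K n)) x hx).trans hn2)
          hn1.le
    _ = ε := ENNReal.add_halves ε

end HausdorffClusterPt

/-! ### Convergence of values, images, measures and supports -/

section Convergence

variable {N : ℕ} {S : Set (EuclideanSpace ℝ (Fin N))}
  {H : Type*} [NormedAddCommGroup H] [InnerProductSpace ℝ H]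
  {A : VecMeas S →ₗ[ℝ] H} {lam : ℝ} {f : H} {μ : VecMeas S}
  {V : ℕ → Submodule ℝ (VecMeas S)} {μd : ℕ → VecMeas S}

/-- The competitors in `hcl` have norm at most that of `μ`, so only the quadratic term has to be
approximated; by nestedness, one competitor serves for all later `n`. -/
theorem tendsto_objective (hlam : 0 < lam) (hV : Monotone V)
    (hcl : A μ ∈ closure (A '' {η | (∃ n, η ∈ V n) ∧ tvNorm η ≤ tvNorm μ}))
    (hμ : IsMinimizer A lam f ⊤ μ) (hμd : ∀ n, IsMinimizer A lam f (V n) (μd n)) :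
    Tendsto (fun n => objective A lam f (μd n)) atTop (𝓝 (objective A lam f μ)) := by
  refine tendsto_order.2 ⟨fun a ha => Eventually.of_forall fun n =>
    ha.trans_le (hμ.2 _ Submodule.mem_top), fun b hb => ?_⟩
  have hopen : IsOpen {y : H | ‖f - y‖ ^ 2 + lam * tvNorm μ < b} :=
    isOpen_lt (by fun_prop) continuous_const
  obtain ⟨_, hy, η, ⟨⟨m, hm⟩, hη⟩, rfl⟩ := mem_closure_iff.1 hcl _ hopen hb
  filter_upwards [eventually_ge_atTop m] with n hn
  calc objective A lam f (μd n) ≤ objective A lam f η := (hμd n).2 η (hV hn hm)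
    _ ≤ ‖f - A η‖ ^ 2 + lam * tvNorm μ := by
        rw [objective]
        gcongr
    _ < b := hy

theorem tendsto_map_minimizers (hlam : 0 < lam) (hμ : IsMinimizer A lam f ⊤ μ)
    (hobj : Tendsto (fun n => objective A lam f (μd n)) atTop (𝓝 (objective A lam f μ))) :
    Tendsto (fun n => A (μd n)) atTop (𝓝 (A μ)) := by
  rw [tendsto_iff_norm_sub_tendsto_zero]
  have h1 : Tendsto (fun n => √(objective A lam f (μd n) - objective A lam f μ)) atTop (𝓝 0) := by
    have h2 := (hobj.sub_const (objective A lam f μ)).sqrt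
    rwa [sub_self, Real.sqrt_zero] at h2
  refine squeeze_zero (fun _ => norm_nonneg _) (fun n => ?_) h1
  exact Real.le_sqrt_of_sq_le (hμ.sq_norm_sub_le hlam Submodule.mem_top)

theorem tendsto_tvNorm_minimizers (hlam : 0 < lam)
    (hobj : Tendsto (fun n => objective A lam f (μd n)) atTop (𝓝 (objective A lam f μ)))
    (hmap : Tendsto (fun n => A (μd n)) atTop (𝓝 (A μ))) :
    Tendsto (fun n => tvNorm (μd n)) atTop (𝓝 (tvNorm μ)) := by
  have h1 : ∀ η : VecMeas S, tvNorm η = (objective A lam f η - ‖f - A η‖ ^ 2) / lam := fun η => by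
    rw [objective]
    field_simp
    ring
  rw [h1 μ]
  simp_rw [h1]
  exact (hobj.sub (((tendsto_const_nhds.sub hmap).norm).pow 2)).div_const lam

variable [CompactSpace S]

/-- If `μ` is a weak limit of elements of an increasing union of subspaces with norm at most
that of `μ`, then `A μ` is a strong limit of images of such elements. -/
theorem mem_closure_image [CompleteSpace H] (hA : IsWeakStarContinuous A) {V : ℕ → Submodule ℝ (VecMeas S)}
    (hV : Monotone V)
    (happ : ∀ φ : C(S, EuclideanSpace ℝ (Fin N)), ∀ ε > 0, ∃ n, ∃ η ∈ V n,
      tvNorm η ≤ tvNorm μ ∧ |pairing S μ φ - pairing S η φ| ≤ ε) :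
    A μ ∈ closure (A '' {η | (∃ n, η ∈ V n) ∧ tvNorm η ≤ tvNorm μ}) := by
  set K : Set (VecMeas S) := {η | (∃ n, η ∈ V n) ∧ tvNorm η ≤ tvNorm μ} with hK
  -- Two competitors from different levels both lie in the larger space, so the union over `n` is
  -- convex.
  have hKc : Convex ℝ K := by
    rintro η ⟨⟨m, hm⟩, hη⟩ ξ ⟨⟨n, hn⟩, hξ⟩ a b ha hb hab
    refine ⟨⟨max m n, (V _).add_mem ((V _).smul_mem _ (hV (le_max_left m n) hm))
      ((V _).smul_mem _ (hV (le_max_right m n) hn))⟩, ?_⟩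
    refine (tvNorm_add_le _ _).trans ?_
    rw [tvNorm_smul, tvNorm_smul, abs_of_nonneg ha, abs_of_nonneg hb]
    calc a * tvNorm η + b * tvNorm ξ ≤ a * tvNorm μ + b * tvNorm μ := by gcongr
      _ = tvNorm μ := by rw [← add_mul, hab, one_mul]
  by_contra hnot
  obtain ⟨ℓ, u, hℓ, hu⟩ := geometric_hahn_banach_closed_point
    (hKc.is_linear_image A.isLinear).closure isClosed_closure hnot
  set g := (InnerProductSpace.toDual ℝ H).symm ℓ with hg
  have hgℓ : ∀ y, inner ℝ g y = ℓ y := fun y => InnerProductSpace.toDual_symm_apply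
  -- Approximating against `A^* g`, with `g` representing the separating functional, within the
  -- separation margin contradicts strict separation.
  obtain ⟨n, η, hηV, hη, hηp⟩ := happ (adjoint hA g) (ℓ (A μ) - u) (sub_pos.2 hu)
  rw [pairing_adjoint, pairing_adjoint, hgℓ, hgℓ] at hηp
  have h1 := hℓ (A η) (subset_closure ⟨η, ⟨⟨n, hηV⟩, hη⟩, rfl⟩)
  have h2 := (le_abs_self _).trans hηp
  linarith

/-- If the full minimizer is unique, the discrete minimizers converge to it weak-star. -/
theorem tendsto_pairing_minimizers (hA : IsWeakStarContinuous A) (hlam : 0 < lam)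
    (hμ : IsMinimizer A lam f ⊤ μ) (hunique : ∀ μ', IsMinimizer A lam f ⊤ μ' → μ' = μ)
    (hmap : Tendsto (fun n => A (μd n)) atTop (𝓝 (A μ)))
    (htv : Tendsto (fun n => tvNorm (μd n)) atTop (𝓝 (tvNorm μ)))
    (φ : C(S, EuclideanSpace ℝ (Fin N))) :
    Tendsto (fun n => pairing S (μd n) φ) atTop (𝓝 (pairing S μ φ)) := by
  obtain ⟨c, hc⟩ := htv.bddAbove_range
  rw [tendsto_iff_ultrafilter]
  intro U hU
  obtain ⟨μ', hμ'⟩ := exists_tendsto_pairing U fun n => hc (Set.mem_range_self n)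
  have hAμ' : A μ' = A μ := by
    refine ext_inner_left ℝ fun g => ?_
    have h1 := hμ' (adjoint hA g)
    simp_rw [pairing_adjoint] at h1
    exact tendsto_nhds_unique h1 (tendsto_const_nhds.inner (hmap.mono_left hU))
  have htv' : tvNorm μ' ≤ tvNorm μ := tvNorm_le_of_tendsto hμ' (htv.mono_left hU)
  have hmin : IsMinimizer A lam f ⊤ μ' := ⟨Submodule.mem_top, fun ξ hξ => by
    refine le_trans ?_ (hμ.2 ξ hξ)
    rw [objective, objective, hAμ']
    gcongr⟩
  rw [← hunique μ' hmin]
  exact hμ' φ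

/-- Under weak-star convergence, the supports asymptotically fill the support of the limit. -/
theorem tendsto_iSup_infEDist_supp {m : ℕ → VecMeas S}
    (h : ∀ φ, Tendsto (fun n => pairing S (m n) φ) atTop (𝓝 (pairing S μ φ))) :
    Tendsto (fun n => ⨆ x ∈ μ.supp, Metric.infEDist x (m n).supp) atTop (𝓝 0) := by
  have hmeet : ∀ x ∈ μ.supp, ∀ r : ℝ, 0 < r →
      ∀ᶠ n in atTop, (Metric.ball x r ∩ (m n).supp).Nonempty := by
    intro x hx r hr
    -- If the ball misses infinitely many supports, each `φ` vanishing off it pairs to zero with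
    -- those measures, hence with `μ`; then `|μ|` vanishes on the half ball.
    by_contra hnot
    have hpos := (Measure.mem_support_iff_forall x).1 hx _ (Metric.ball_mem_nhds x (half_pos hr))
    refine hpos.ne' (variation_ball_half_eq_zero μ x hr fun φ hφ => ?_)
    have hzero : ∃ᶠ n in atTop, pairing S (m n) φ ∈ ({0} : Set ℝ) := by
      refine (not_eventually.1 hnot).mono fun n hn => ?_
      refine abs_nonpos_iff.1 ((abs_pairing_le_of_ae (m n) φ (c := 0) ?_).trans (by simp))
      have hae : (m n).supp ∈ ae (m n).variation := Measure.support_mem_ae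
      filter_upwards [hae] with y hy
      rw [hφ y fun hyb => hn ⟨y, hyb, hy⟩, norm_zero]
    exact isClosed_singleton.mem_of_frequently_of_tendsto hzero (h φ)
  rw [ENNReal.tendsto_nhds_zero]
  intro ε hε
  obtain ⟨r, hr, hrε⟩ : ∃ r : ℝ, 0 < r ∧ ENNReal.ofReal (2 * r) ≤ ε := by
    obtain ⟨t, ht0, ht⟩ := ENNReal.lt_iff_exists_nnreal_btwn.1 hε
    refine ⟨t / 2, half_pos (NNReal.coe_pos.2 (ENNReal.coe_pos.1 ht0)), ?_⟩
    rw [mul_div_cancel₀ _ two_ne_zero, ENNReal.ofReal_coe_nnreal]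
    exact ht.le
  obtain ⟨T, hTs, hTf, hT⟩ := (isClosed_supp μ).isCompact.finite_cover_balls hr
  filter_upwards [(Filter.eventually_all_finite hTf).2 fun x hx => hmeet x (hTs hx) r hr] with n hn
  refine iSup₂_le fun x hx => ?_
  obtain ⟨z, hzT, hxz⟩ := Set.mem_iUnion₂.1 (hT hx)
  obtain ⟨y, hyz, hy⟩ := hn z hzT
  refine (Metric.infEDist_le_edist_of_mem hy).trans (le_trans ?_ hrε)
  rw [edist_dist]
  refine ENNReal.ofReal_le_ofReal ?_
  have h1 : dist x z < r := hxz
  have h2 : dist y z < r := hyz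
  linarith [dist_triangle_right x y z]

/-- The supports of the discrete minimizers concentrate near the level set. -/
theorem tendsto_iSup_infEDist_levelSet [CompleteSpace H] (hA : IsWeakStarContinuous A) (hlam : 0 < lam)
    (hμ : IsMinimizer A lam f ⊤ μ) (hμd : ∀ n, IsMinimizer A lam f (V n) (μd n))
    (hmap : Tendsto (fun n => A (μd n)) atTop (𝓝 (A μ)))
    {ι : ℕ → Type*} [∀ n, Countable (ι n)] {E : (n : ℕ) → ι n → Set S}
    (hEm : ∀ n k, MeasurableSet (E n k)) (hEU : ∀ n, ⋃ k, E n k = Set.univ)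
    (hEV : ∀ n k, (μd n).restrict (E n k) ∈ V n)
    (hosc : ∀ φ : C(S, EuclideanSpace ℝ (Fin N)), ∀ ε > 0, ∀ᶠ n in atTop, ∀ k, ∀ x ∈ E n k,
      ∀ y ∈ E n k, dist (φ x) (φ y) ≤ ε) :
    Tendsto (fun n => ⨆ x ∈ (μd n).supp,
      Metric.infEDist x (levelSet hA f μ (lam / 2))) atTop (𝓝 0) := by
  set p := adjoint hA (f - A μ) with hp
  have hptend := tendsto_adjoint hA (tendsto_const_nhds (x := f).sub hmap)
  rw [← hp] at hptend
  rw [ENNReal.tendsto_nhds_zero]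
  intro ε hε
  -- The margin `4δ` pays for the oscillation `3δ` of `q` on a cell (one `δ` for `p`, two for
  -- passing between `p` and `q`) and a last `δ` for comparing `q` with `p` at `x`. An empty level
  -- set is at distance `∞`, so it is covered too.
  have hgap : ∃ δ > 0, ∀ x, ε ≤ Metric.infEDist x (levelSet hA f μ (lam / 2)) →
      ‖p x‖ < lam / 2 - 4 * δ := by
    set T := {x : S | ε ≤ Metric.infEDist x (levelSet hA f μ (lam / 2))} with hT
    have hTc : IsCompact T :=
      (isClosed_le continuous_const Metric.continuous_infEDist).isCompact
    rcases T.eq_empty_or_nonempty with h0 | hne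
    · exact ⟨1, one_pos, fun x hx => absurd (h0 ▸ hx : x ∈ (∅ : Set S)) (Set.notMem_empty x)⟩
    · obtain ⟨x₀, hx₀, hmax⟩ := hTc.exists_isMaxOn hne p.continuous.norm.continuousOn
      have hlt : ‖p x₀‖ < lam / 2 := by
        refine lt_of_le_of_ne (hμ.norm_adjoint_le hA hlam x₀) fun heq => ?_
        have h1 : Metric.infEDist x₀ (levelSet hA f μ (lam / 2)) = 0 :=
          Metric.infEDist_zero_of_mem heq
        exact hε.not_ge (h1 ▸ hx₀)
      refine ⟨(lam / 2 - ‖p x₀‖) / 8, by linarith, fun x hx => ?_⟩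
      have h2 : ‖p x‖ ≤ ‖p x₀‖ := hmax hx
      linarith
  obtain ⟨δ, hδ, hgap⟩ := hgap
  filter_upwards [hosc p δ hδ, (Metric.tendsto_nhds.1 hptend) δ hδ] with n hn hpn
  refine iSup₂_le fun x hx => ?_
  by_contra! hlt
  set q := adjoint hA (f - A (μd n)) with hq
  have hd : ∀ y, dist (q y) (p y) ≤ δ := fun y => (ContinuousMap.dist_apply_le_dist y).trans hpn.le
  have h1 := (hμd n).le_norm_adjoint_of_mem_supp hA hlam (hEm n) (hEU n) (hEV n) (δ := 3 * δ)
    (fun k y hy z hz => by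
      have h2 := hn k y hy z hz
      have h3 := hd z
      rw [dist_comm] at h3
      linarith [dist_triangle4 (q y) (p y) (p z) (q z), hd y]) hx
  have h4 := hgap x hlt.le
  have h5 := hd x
  rw [dist_eq_norm] at h5
  linarith [norm_sub_norm_le (q x) (p x)]

end Convergence

/-! ### Small mesh and uniform continuity -/

section Mesh

theorem eventually_dist_le {N : ℕ} {S : Set (EuclideanSpace ℝ (Fin N))} [CompactSpace S]
    {ι : ℕ → Type*} {E : (n : ℕ) → ι n → Set S}
    (hmesh : Tendsto (fun n => ⨆ k, Metric.ediam (E n k)) atTop (𝓝 0))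
    (φ : C(S, EuclideanSpace ℝ (Fin N))) {ε : ℝ} (hε : 0 < ε) :
    ∀ᶠ n in atTop, ∀ k, ∀ x ∈ E n k, ∀ y ∈ E n k, dist (φ x) (φ y) ≤ ε := by
  have hu := CompactSpace.uniformContinuous_of_continuous φ.continuous
  obtain ⟨δ, hδ, h⟩ := EMetric.uniformContinuous_iff.1 hu (ENNReal.ofReal ε)
    (ENNReal.ofReal_pos.2 hε)
  filter_upwards [hmesh.eventually (gt_mem_nhds hδ)] with n hn k x hx y hy
  have h1 : edist x y < δ :=
    ((Metric.edist_le_ediam_of_mem hx hy).trans (le_iSup (fun k => Metric.ediam (E n k)) k)).trans_lt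
      hn
  rw [dist_edist]
  exact ENNReal.toReal_le_of_le_ofReal hε.le (h h1).le

end Mesh

end VecMeas

theorem proposition6p4 {N : ℕ} (S : Set (EuclideanSpace ℝ (Fin N))) [CompactSpace S]
    {H : Type*} [NormedAddCommGroup H] [InnerProductSpace ℝ H] [CompleteSpace H]
    (A : VecMeas S →ₗ[ℝ] H) (hA : VecMeas.IsWeakStarContinuous A)
    (lam : ℝ) (hlam : 0 < lam) (f : H)
    -- the generating measures of the spaces `V n = VecMeas.gsmSpace (ν n)`
    (I : ℕ → Set ℕ) (ν : (n : ℕ) → I n → Measure S)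
    (hν : ∀ n, VecMeas.IsGeneratingFamily (ν n))
    (hnested : Monotone fun n => VecMeas.gsmSpace (ν n))
    (hclosed : ∀ n, IsClosed[VecMeas.weakStar S] (VecMeas.gsmSpace (ν n) : Set (VecMeas S)))
    -- compatible partitions, with mesh tending to zero
    (E : (n : ℕ) → I n → Set S)
    (hE : ∀ n, VecMeas.IsCompatiblePartition (ν n) (E n))
    (hmesh : Tendsto (fun n => ⨆ k, Metric.ediam (E n k)) atTop (𝓝 0))
    -- a minimizer over the whole space and a minimizer over each `V n`
    (μ : VecMeas S) (hμ : VecMeas.IsMinimizer A lam f ⊤ μ)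
    (μd : ℕ → VecMeas S)
    (hμd : ∀ n, VecMeas.IsMinimizer A lam f (VecMeas.gsmSpace (ν n)) (μd n)) :
    Tendsto (fun n => ⨆ x ∈ (μd n).supp,
        Metric.infEDist x (VecMeas.levelSet hA f μ (lam / 2))) atTop (𝓝 0) ∧
    (∀ C : Set S, IsCompact C → VecMeas.IsHausdorffClusterPt (fun n => (μd n).supp) C →
        C ⊆ VecMeas.levelSet hA f μ (lam / 2)) ∧
    -- the minimizer over the whole space is unique
    ((∀ μ' : VecMeas S, VecMeas.IsMinimizer A lam f ⊤ μ' → μ' = μ) →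
      Tendsto (fun n => ⨆ x ∈ μ.supp, Metric.infEDist x (μd n).supp) atTop (𝓝 0) ∧
      ∀ C : Set S, IsCompact C → VecMeas.IsHausdorffClusterPt (fun n => (μd n).supp) C →
        μ.supp ⊆ C) := by
  have hosc := fun φ ε hε => VecMeas.eventually_dist_le hmesh φ (ε := ε) hε
  have hcl := VecMeas.mem_closure_image (μ := μ) hA hnested fun φ ε hε => by
    -- The `+ 1` keeps the denominator of the oscillation tolerance positive when `μ` and `φ`
    -- vanish.
    have hc : 0 < 2 * VecMeas.tvNorm μ + ‖φ‖ + 1 := by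
      have := VecMeas.tvNorm_nonneg μ
      positivity
    obtain ⟨n, hn⟩ := (hosc φ _ (div_pos hε hc)).exists
    obtain ⟨η, hηV, hη, h⟩ := (hE n).exists_abs_pairing_sub_le (hν n) μ (div_pos hε hc) hn
    refine ⟨n, η, hηV, hη, h.trans ?_⟩
    rw [div_mul_eq_mul_div, div_le_iff₀ hc]
    nlinarith
  have hobj := VecMeas.tendsto_objective hlam hnested hcl hμ hμd
  have hmap := VecMeas.tendsto_map_minimizers hlam hμ hobj
  have htv := VecMeas.tendsto_tvNorm_minimizers hlam hobj hmap
  have hlevel := VecMeas.tendsto_iSup_infEDist_levelSet hA hlam hμ hμd hmap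
    (fun n => (hE n).measurableSet) (fun n => (hE n).iUnion_eq)
    (fun n k => by
      have := (hν n).isProbabilityMeasure
      exact (hE n).restrict_mem (hμd n).1 k) hosc
  refine ⟨hlevel, fun C _ hC => hC.subset_of_tendsto
    (isClosed_eq (VecMeas.adjoint hA (f - A μ)).continuous.norm continuous_const) hlevel,
    fun hunique => ?_⟩
  have hsupp := VecMeas.tendsto_iSup_infEDist_supp
    (VecMeas.tendsto_pairing_minimizers hA hlam hμ hunique hmap htv)
  exact ⟨hsupp, fun C hCc hC => hC.superset_of_tendsto hCc.isClosed hsupp⟩
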